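/- Let $U\subset\mathbb{R}^4$ be open, with coordinates $(u,v,x_1,x_2)$, let $H=H(u,x_1,x_2)$ be smooth on $U$, and let $$g=2\,du\,dv+H(u,x_1,x_2)\,du^2+dx_1^2+dx_2^2 .$$ Write $\rho$ for the Ricci tensor, $W$ for the Weyl tensor and $\Delta_xH=\partial_{x_1}^2H+\partial_{x_2}^2H$. For an open set $V\subset U$, a function $f$ on $V$ and a constant $\mu\in\mathbb{R}$, say that $(V,g,f,\mu)$ is isotropic quasi-Einstein if $f$ is smooth, $\operatorname{Hes}_f+\rho-\mu\,df\otimes df=\lambda g$ on $V$ for some function $\lambda$, and $\nabla f$ is lightlike (null and non-zero) at every point of $V$. Assume that $(U,g)$ is not locally conformally flat. Then the following are equivalent: (i) $(U,g)$ is locally isotropic quasi-Einstein for some constant $\mu$, i.e. every point of $U$ has an open neighbourhood $N\subset U$ with a function $f$ on $N$ such that $(N,g,f,\mu)$ is isotropic quasi-Einstein; (i') $(U,g)$ is locally isotropic quasi-Einstein, in the sense of (i), for every constant $\mu\in\mathbb{R}$; (ii) the Weyl tensor is harmonic on $U$, i.e. $\operatorname{div}W=0$; (iii) $\Delta_xH$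 is locally a function of $u$ only, i.e. every point of $U$ has an open neighbourhood $N\subset U$ on which $\Delta_xH=\varphi(u)$ for some function $\varphi$. If moreover all slices $U\cap\{u=c\}$ are connected or empty (for example $U=\mathbb{R}^4$), then these conditions hold if and only if $\Delta_xH=\varphi(u)$ on all of $U$ for a single function $\varphi$. Furthermore, let $V\subset U$ be open, non-empty and connected such that $(V,g)$ is not locally conformally flat, let $\mu\in\mathbb{R}$ be arbitrary, and let $(V,g,f,\mu)$ be isotropic quasi-Einstein. Then $W(\cdot,\cdot,\cdot,\nabla f)=0$ on $V$, and near every point of $V$ the function $f=f(u)$ is a smooth function of $u$ only which satisfies $$f''(u)-\mu f'(u)^2-\tfrac12\Delta_xH=0 .$$ If all slices $V\cap\{u=c\}$ are connected or empty, then $f=f(u)$ on all of $V$ for a single smooth function of $u$ that satisfies this equation. -/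

import Mathlib

open scoped ContDiff

noncomputable section

namespace PpWave

/-! Local pseudo-Riemannian geometry in a coordinate domain of `ℝ⁴`. Tensor fields are given by their
components in the coordinate frame; the coordinates `(u, v, x₁, x₂)` have indices `0, 1, 2, 3`. -/

/-- Coordinate space with coordinates `p 0 = u`, `p 1 = v`, `p 2 = x₁`, `p 3 = x₂`. -/
abbrev Pt : Type := Fin 4 → ℝ

/-- A field of bilinear forms, through its matrix `g p i j = g(∂ᵢ, ∂ⱼ)` at `p`. -/
abbrev MetricField : Type := Pt → Matrix (Fin 4) (Fin 4) ℝ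

/-- The partial derivative `∂F/∂xᵢ` at `p`. -/
def pd (i : Fin 4) (F : Pt → ℝ) (p : Pt) : ℝ := fderiv ℝ F p (Pi.single i 1)

/-- Christoffel symbols `Γᵏᵢⱼ` of the Levi-Civita connection: `∇_{∂ᵢ} ∂ⱼ = Σₖ Γᵏᵢⱼ ∂ₖ`. -/
def christoffel (g : MetricField) (k i j : Fin 4) (p : Pt) : ℝ :=
  (1 / 2) * ∑ l, (g p)⁻¹ k l *
    (pd i (fun q => g q j l) p + pd j (fun q => g q i l) p - pd l (fun q => g q i j) p)

/-- The `∂ₗ`-component of `R(∂ᵢ, ∂ⱼ)∂ₖ`, with the sign convention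
`R(X, Y) = ∇_{[X, Y]} - [∇_X, ∇_Y]`. -/
def riemannUp (g : MetricField) (i j k l : Fin 4) (p : Pt) : ℝ :=
  -(pd i (christoffel g l j k) p - pd j (christoffel g l i k) p
    + ∑ m, (christoffel g l i m p * christoffel g m j k p
        - christoffel g l j m p * christoffel g m i k p))

/-- The curvature tensor `R(∂ᵢ, ∂ⱼ, ∂ₖ, ∂ₗ) = g(R(∂ᵢ, ∂ⱼ)∂ₖ, ∂ₗ)`. -/
def riemann (g : MetricField) (i j k l : Fin 4) (p : Pt) : ℝ :=
  ∑ m, riemannUp g i j k m p * g p m l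

/-- The Ricci tensor `ρ(X, Y) = tr (Z ↦ R(X, Z)Y)`
(positive on round spheres with the sign convention above). -/
def ricci (g : MetricField) (i j : Fin 4) (p : Pt) : ℝ :=
  ∑ a, riemannUp g i a j a p

/-- The scalar curvature `τ`. -/
def scalarCurv (g : MetricField) (p : Pt) : ℝ :=
  ∑ i, ∑ j, (g p)⁻¹ i j * ricci g i j p

/-- The Weyl tensor in dimension four. -/
def weyl (g : MetricField) (i j k l : Fin 4) (p : Pt) : ℝ :=
  riemann g i j k l p
    + scalarCurv g p / 6 * (g p i k * g p j l - g p i l * g p j k)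
    + (1 / 2) * (ricci g i l p * g p j k - ricci g i k p * g p j l
        + ricci g j k p * g p i l - ricci g j l p * g p i k)

/-- The covariant derivative `(∇_{∂ₘ} T)(∂ᵢ, ∂ⱼ, ∂ₖ, ∂ₗ)` of a `(0,4)`-tensor field. -/
def covDeriv (g : MetricField) (T : Fin 4 → Fin 4 → Fin 4 → Fin 4 → Pt → ℝ)
    (m i j k l : Fin 4) (p : Pt) : ℝ :=
  pd m (T i j k l) p
    - ∑ a, (christoffel g a m i p * T a j k l p + christoffel g a m j p * T i a k l p
        + christoffel g a m k p * T i j a l p + christoffel g a m l p * T i j k a p)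

/-- The divergence `(div W)(∂ᵢ, ∂ⱼ, ∂ₖ)`: the metric trace of `(∇_· W)(∂ᵢ, ∂ⱼ, ∂ₖ, ·)`. -/
def divWeyl (g : MetricField) (i j k : Fin 4) (p : Pt) : ℝ :=
  ∑ m, ∑ l, (g p)⁻¹ m l * covDeriv g (weyl g) m i j k l p

/-- The Weyl tensor of `g` is harmonic (divergence-free) on `U`. -/
def HarmonicWeyl (g : MetricField) (U : Set Pt) : Prop :=
  ∀ p ∈ U, ∀ i j k, divWeyl g i j k p = 0

/-- `(U, g)` is locally conformally flat: every point has a neighbourhood on which some metric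
`e^{2σ} g` is flat. -/
def LocallyConformallyFlat (g : MetricField) (U : Set Pt) : Prop :=
  ∀ p ∈ U, ∃ N : Set Pt, IsOpen N ∧ p ∈ N ∧ N ⊆ U ∧
    ∃ σ : Pt → ℝ, ContDiffOn ℝ ∞ σ N ∧
      ∀ q ∈ N, ∀ i j k l, riemann (fun r => Real.exp (2 * σ r) • g r) i j k l q = 0

/-- The gradient of `f`, component `i`. -/
def grad (g : MetricField) (f : Pt → ℝ) (p : Pt) (i : Fin 4) : ℝ :=
  ∑ j, (g p)⁻¹ i j * pd j f p

/-- The Hessian `Hes_f(∂ᵢ, ∂ⱼ)`. -/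
def hess (g : MetricField) (f : Pt → ℝ) (i j : Fin 4) (p : Pt) : ℝ :=
  pd i (pd j f) p - ∑ k, christoffel g k i j p * pd k f p

/-- `(U, g, f, μ)` is quasi-Einstein: `f` is smooth and
`Hes_f + ρ - μ df ⊗ df = λ g` on `U` for some function `λ`. -/
def QuasiEinstein (g : MetricField) (U : Set Pt) (f : Pt → ℝ) (μ : ℝ) : Prop :=
  ContDiffOn ℝ ∞ f U ∧ ∃ lam : Pt → ℝ, ∀ p ∈ U, ∀ i j,
    hess g f i j p + ricci g i j p - μ * (pd i f p * pd j f p) = lam p * g p i j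

/-- `X` is a lightlike (non-zero null) tangent vector at `p`. -/
def Lightlike (g : MetricField) (p : Pt) (X : Fin 4 → ℝ) : Prop :=
  X ≠ 0 ∧ ∑ i, ∑ j, g p i j * X i * X j = 0

/-- `(U, g, f, μ)` is isotropic quasi-Einstein: quasi-Einstein with `∇f` lightlike on `U`. -/
def IsotropicQE (g : MetricField) (U : Set Pt) (f : Pt → ℝ) (μ : ℝ) : Prop :=
  QuasiEinstein g U f μ ∧ ∀ p ∈ U, Lightlike g p (grad g f p)

/-- Every point of `U` has a neighbourhood carrying a potential function that makes it isotropic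
quasi-Einstein with constant `μ`. -/
def LocallyIsotropicQE (g : MetricField) (U : Set Pt) (μ : ℝ) : Prop :=
  ∀ p ∈ U, ∃ N : Set Pt, IsOpen N ∧ p ∈ N ∧ N ⊆ U ∧ ∃ f : Pt → ℝ, IsotropicQE g N f μ

/-- The function `H(u, x₁, x₂)`, regarded as a function on coordinate space. -/
def lift (H : ℝ → ℝ → ℝ → ℝ) (p : Pt) : ℝ := H (p 0) (p 2) (p 3)

/-- The pp-wave metric `2 du dv + H(u, x₁, x₂) du² + dx₁² + dx₂²`. -/
def ppMetric (H : ℝ → ℝ → ℝ → ℝ) : MetricField := fun p =>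
  !![lift H p, 1, 0, 0;
     1, 0, 0, 0;
     0, 0, 1, 0;
     0, 0, 0, 1]

/-- The spatial Laplacian `Δₓ H = ∂²H/∂x₁² + ∂²H/∂x₂²`. -/
def lapX (H : ℝ → ℝ → ℝ → ℝ) (p : Pt) : ℝ :=
  pd 2 (pd 2 (lift H)) p + pd 3 (pd 3 (lift H)) p

/-- `F = φ(u)` on `U`. -/
def FunctionOfU (F : Pt → ℝ) (U : Set Pt) : Prop :=
  ∃ φ : ℝ → ℝ, ∀ p ∈ U, F p = φ (p 0)

/-- Near every point of `U`, `F` is a function of `u`. -/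
def LocallyFunctionOfU (F : Pt → ℝ) (U : Set Pt) : Prop :=
  ∀ p ∈ U, ∃ N : Set Pt, IsOpen N ∧ p ∈ N ∧ N ⊆ U ∧ FunctionOfU F N

/-- On the open set `U`, `f = f(u)` is a smooth function of `u` with
`f'' - μ (f')² - ½ Δₓ H = 0`. -/
def SolvesPotentialODE (H : ℝ → ℝ → ℝ → ℝ) (μ : ℝ) (f : Pt → ℝ) (U : Set Pt) : Prop :=
  ∃ φ : ℝ → ℝ, ContDiffOn ℝ ∞ φ ((fun p : Pt => p 0) '' U) ∧ ∀ p ∈ U, f p = φ (p 0) ∧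
    deriv (deriv φ) (p 0) - μ * deriv φ (p 0) ^ 2 - (1 / 2) * lapX H p = 0

/-- Near every point of `U`, `f = f(u)` solves the potential equation. -/
def LocallySolvesPotentialODE (H : ℝ → ℝ → ℝ → ℝ) (μ : ℝ) (f : Pt → ℝ) (U : Set Pt) : Prop :=
  ∀ p ∈ U, ∃ N : Set Pt, IsOpen N ∧ p ∈ N ∧ N ⊆ U ∧ SolvesPotentialODE H μ f N

/-- All slices `U ∩ {u = c}` are connected (or empty). -/
def ConnectedSlices (U : Set Pt) : Prop :=
  ∀ c : ℝ, IsPreconnected {p : Pt | p ∈ U ∧ p 0 = c}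

end PpWave

end

open scoped ContDiff Topology

noncomputable section

namespace PpWave

/-! ### Partial derivatives -/

/-! Everything reduces to the scalar $\Delta_xH$. The curvature of a pp-wave is built from the
Hessian of $H$ in $x$: the Ricci tensor is $-\frac12\Delta_xH\,du^2$, the scalar curvature vanishes,
and $W$ is given by the trace-free part of that Hessian. Since third derivatives commute, the
divergence of the trace-free part is half the gradient of the trace, so $\operatorname{div}W=0$ says
that $\Delta_xH$ has no $v$- or $x$-derivatives (`harmonicWeyl_ppMetric_iff`).

For an isotropic potential, differentiating $|\nabla f|^2=0$ and contracting the quasi-Einstein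
equation with $\nabla f$ gives $\lambda\,df=\rho(\nabla f,\cdot)$. The Ricci tensor is nilpotent,
hence $\lambda=0$ (`IsotropicQE.equations`). Then $d f_v=\mu f_v\,df$, so on a connected set $f_v$
vanishes everywhere or nowhere. If nowhere, equality of mixed third derivatives of $f$ makes $H$
affine in $x$ and the metric flat. If everywhere, nullity leaves $f=f(u)$, and the only remaining
equation is the ODE, which determines $\Delta_xH$ from $u$. In both cases $\Delta_xH$ is locally a
function of $u$. Conversely, if it is, the ODE can be solved locally with $f'\ne0$ for every $\mu$
(`exists_solution_riccati`). -/

theorem pd_congr {F G : Pt → ℝ} {U : Set Pt} (hU : IsOpen U) (h : ∀ q ∈ U, F q = G q)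
    (i : Fin 4) {p : Pt} (hp : p ∈ U) : pd i F p = pd i G p := by
  have : F =ᶠ[𝓝 p] G := Filter.eventually_of_mem (hU.mem_nhds hp) h
  simp only [pd, this.fderiv_eq]

@[simp] theorem pd_const (i : Fin 4) (c : ℝ) (p : Pt) : pd i (fun _ => c) p = 0 := by
  simp [pd]

theorem pd_const_mul (i : Fin 4) (c : ℝ) (F : Pt → ℝ) (p : Pt) :
    pd i (fun q => c * F q) p = c * pd i F p := by
  have : (fun q => c * F q) = c • F := rfl
  simp only [pd, this, fderiv_const_smul_field]
  rfl

theorem pd_neg (i : Fin 4) (F : Pt → ℝ) (p : Pt) :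
    pd i (fun q => -F q) p = -pd i F p := by
  simpa using pd_const_mul i (-1) F p

theorem pd_add {F G : Pt → ℝ} {p : Pt} (hF : DifferentiableAt ℝ F p)
    (hG : DifferentiableAt ℝ G p) (i : Fin 4) :
    pd i (fun q => F q + G q) p = pd i F p + pd i G p := by
  simp only [pd, fderiv_fun_add hF hG]; rfl

theorem pd_sub {F G : Pt → ℝ} {p : Pt} (hF : DifferentiableAt ℝ F p)
    (hG : DifferentiableAt ℝ G p) (i : Fin 4) :
    pd i (fun q => F q - G q) p = pd i F p - pd i G p := by
  simp only [pd, fderiv_fun_sub hF hG]; rfl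

theorem pd_mul {F G : Pt → ℝ} {p : Pt} (hF : DifferentiableAt ℝ F p)
    (hG : DifferentiableAt ℝ G p) (i : Fin 4) :
    pd i (fun q => F q * G q) p = pd i F p * G p + F p * pd i G p := by
  simp only [pd, fderiv_fun_mul hF hG]
  simp; ring

theorem fderiv_apply_eq_sum_pd (F : Pt → ℝ) (p d : Pt) :
    fderiv ℝ F p d = ∑ i, d i * pd i F p := by
  conv_lhs => rw [pi_eq_sum_univ' d]
  simp [pd, map_sum]

theorem contDiffOn_pd {F : Pt → ℝ} {U : Set Pt} (hU : IsOpen U) (hF : ContDiffOn ℝ ∞ F U)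
    (i : Fin 4) : ContDiffOn ℝ ∞ (pd i F) U :=
  (hF.fderiv_of_isOpen hU (m := ∞) (by simp)).clm_apply contDiffOn_const

theorem ContDiffOn.differentiableAt_of_isOpen {F : Pt → ℝ} {U : Set Pt} (hU : IsOpen U)
    (hF : ContDiffOn ℝ ∞ F U) {p : Pt} (hp : p ∈ U) : DifferentiableAt ℝ F p :=
  (hF.contDiffAt (hU.mem_nhds hp)).differentiableAt (by simp)

theorem pd_comm {F : Pt → ℝ} {U : Set Pt} (hU : IsOpen U) (hF : ContDiffOn ℝ ∞ F U)
    (i j : Fin 4) {p : Pt} (hp : p ∈ U) : pd i (pd j F) p = pd j (pd i F) p := by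
  have hF' := hF.contDiffAt (hU.mem_nhds hp)
  have hd : DifferentiableAt ℝ (fderiv ℝ F) p :=
    (hF'.fderiv_right (m := ∞) (by simp)).differentiableAt (by simp)
  have key : ∀ a b : Fin 4, pd a (pd b F) p
      = fderiv ℝ (fderiv ℝ F) p (Pi.single a 1) (Pi.single b 1) := by
    intro a b
    have : pd b F = fun q => fderiv ℝ F q (Pi.single b 1) := rfl
    rw [pd, this, fderiv_clm_apply hd (differentiableAt_const _)]
    simp
  rw [key, key]
  exact (hF'.isSymmSndFDerivAt (by simp only [minSmoothness_of_isRCLikeNormedField]; exact WithTop.coe_le_coe.2 (le_top (a := (2 : ℕ∞))))).eq _ _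

/-! ### Functions that do not depend on `v` -/

theorem pd_add_single {F : Pt → ℝ} {k : Fin 4}
    (hF : ∀ p t, F (p + Pi.single k t) = F p) (i : Fin 4) (p : Pt) (t : ℝ) :
    pd i F (p + Pi.single k t) = pd i F p := by
  simp only [pd, ← fderiv_comp_add_right, hF]

/-- Differentiability is not assumed: where it fails, `fderiv` is zero by convention. The
$v$-derivatives of `lift H` and of its partials therefore vanish at every point, also outside the
domain of smoothness. -/
theorem pd_eq_zero_of_invariant {F : Pt → ℝ} {k : Fin 4}
    (hF : ∀ p t, F (p + Pi.single k t) = F p) (p : Pt) : pd k F p = 0 := by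
  by_cases hd : DifferentiableAt ℝ F p
  · have h := hd.hasFDerivAt.hasLineDerivAt (Pi.single k 1)
    have h' : HasDerivAt (fun _ : ℝ => F p) (fderiv ℝ F p (Pi.single k 1)) 0 := by
      have hk : ∀ t : ℝ, F (p + t • Pi.single k (1 : ℝ)) = F p := fun t => by
        rw [← hF p t, ← Pi.single_smul]; simp
      simpa only [HasLineDerivAt, hk] using h
    exact h'.unique (hasDerivAt_const _ _)
  · simp [pd, fderiv_zero_of_not_differentiableAt hd]

theorem lift_add_single (H : ℝ → ℝ → ℝ → ℝ) (p : Pt) (t : ℝ) :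
    lift H (p + Pi.single 1 t) = lift H p := by
  simp [lift]

@[simp] theorem pd_one_lift (H : ℝ → ℝ → ℝ → ℝ) (p : Pt) : pd 1 (lift H) p = 0 :=
  pd_eq_zero_of_invariant (lift_add_single H) p

@[simp] theorem pd_one_pd_lift (H : ℝ → ℝ → ℝ → ℝ) (i : Fin 4) (p : Pt) :
    pd 1 (pd i (lift H)) p = 0 :=
  pd_eq_zero_of_invariant (pd_add_single (lift_add_single H) i) p

@[simp] theorem pd_one_pd_pd_lift (H : ℝ → ℝ → ℝ → ℝ) (i j : Fin 4) (p : Pt) :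
    pd 1 (pd i (pd j (lift H))) p = 0 :=
  pd_eq_zero_of_invariant (pd_add_single (pd_add_single (lift_add_single H) j) i) p

@[simp] theorem pd_pd_one_lift (H : ℝ → ℝ → ℝ → ℝ) (i : Fin 4) (p : Pt) :
    pd i (pd 1 (lift H)) p = 0 := by
  have : pd 1 (lift H) = fun _ => 0 := funext (pd_one_lift H)
  rw [this, pd_const]

/-! ### Curvature of the pp-wave metric -/

theorem ppMetric_inv (H : ℝ → ℝ → ℝ → ℝ) (p : Pt) :
    (ppMetric H p)⁻¹ = !![0, 1, 0, 0; 1, -lift H p, 0, 0; 0, 0, 1, 0; 0, 0, 0, 1] := by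
  apply Matrix.inv_eq_right_inv
  ext i j
  fin_cases i <;> fin_cases j <;> simp [ppMetric, Matrix.mul_apply, Fin.sum_univ_four]

theorem pd_ppMetric (H : ℝ → ℝ → ℝ → ℝ) (i j k : Fin 4) (p : Pt) :
    pd i (fun q => ppMetric H q j k) p = if j = 0 ∧ k = 0 then pd i (lift H) p else 0 := by
  fin_cases j <;> fin_cases k <;> simp [ppMetric]

/-- The Christoffel symbols of `ppMetric H`. -/
theorem christoffel_ppMetric (H : ℝ → ℝ → ℝ → ℝ) (k i j : Fin 4) :
    christoffel (ppMetric H) k i j = fun p =>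
      ((if k = 1 ∧ j = 0 then 1 / 2 else 0 : ℝ) * pd i (lift H) p
        -- The condition `j ≠ 0` keeps $\Gamma^v_{uu}=\frac12H_u$ from being counted twice.
        + (if k = 1 ∧ i = 0 ∧ j ≠ 0 then 1 / 2 else 0 : ℝ) * pd j (lift H) p)
        - (if (k = 2 ∨ k = 3) ∧ i = 0 ∧ j = 0 then 1 / 2 else 0 : ℝ) * pd k (lift H) p := by
  funext p
  simp only [christoffel, ppMetric_inv, pd_ppMetric, Fin.sum_univ_four]
  fin_cases k <;> fin_cases i <;> fin_cases j <;> simp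

-- The products $\Gamma\Gamma$ survive only for $i=j=0$ and cancel by antisymmetry, so the curvature
-- is linear in the second derivatives of $H$.
set_option maxHeartbeats 4000000 in
theorem riemannUp_ppMetric {H : ℝ → ℝ → ℝ → ℝ} {U : Set Pt} (hU : IsOpen U)
    (hH : ContDiffOn ℝ ∞ (lift H) U) (i j k l : Fin 4) {p : Pt} (hp : p ∈ U) :
    riemannUp (ppMetric H) i j k l p =
      1 / 2 * ((if k = 0 ∧ l ≠ 0 then
        (if j = 0 then pd i (pd l (lift H)) p else 0)
          - (if i = 0 then pd j (pd l (lift H)) p else 0) else 0)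
      - if l = 1 ∧ k ≠ 0 then
        (if j = 0 then pd i (pd k (lift H)) p else 0)
          - (if i = 0 then pd j (pd k (lift H)) p else 0) else 0) := by
  have h02 := pd_comm hU hH 0 2 hp
  have h03 := pd_comm hU hH 0 3 hp
  have h23 := pd_comm hU hH 2 3 hp
  simp only [riemannUp, christoffel_ppMetric, Fin.sum_univ_four]
  fin_cases i <;> fin_cases j <;> fin_cases k <;> fin_cases l <;>
    simp [pd_const_mul, pd_neg] <;> linarith

theorem riemann_ppMetric {H : ℝ → ℝ → ℝ → ℝ} {U : Set Pt} (hU : IsOpen U)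
    (hH : ContDiffOn ℝ ∞ (lift H) U) (i j k l : Fin 4) {p : Pt} (hp : p ∈ U) :
    riemann (ppMetric H) i j k l p =
      1 / 2 * ((if k = 0 ∧ l ≠ 0 then
        (if j = 0 then pd i (pd l (lift H)) p else 0)
          - (if i = 0 then pd j (pd l (lift H)) p else 0) else 0)
      - if l = 0 ∧ k ≠ 0 then
        (if j = 0 then pd i (pd k (lift H)) p else 0)
          - (if i = 0 then pd j (pd k (lift H)) p else 0) else 0) := by
  simp only [riemann, riemannUp_ppMetric hU hH _ _ _ _ hp, Fin.sum_univ_four]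
  fin_cases l <;> simp [ppMetric]

theorem ricci_ppMetric {H : ℝ → ℝ → ℝ → ℝ} {U : Set Pt} (hU : IsOpen U)
    (hH : ContDiffOn ℝ ∞ (lift H) U) (i j : Fin 4) {p : Pt} (hp : p ∈ U) :
    ricci (ppMetric H) i j p = if i = 0 ∧ j = 0 then -(1 / 2) * lapX H p else 0 := by
  simp only [ricci, riemannUp_ppMetric hU hH _ _ _ _ hp, Fin.sum_univ_four, lapX]
  fin_cases i <;> fin_cases j <;> simp <;> ring

theorem scalarCurv_ppMetric {H : ℝ → ℝ → ℝ → ℝ} {U : Set Pt} (hU : IsOpen U)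
    (hH : ContDiffOn ℝ ∞ (lift H) U) {p : Pt} (hp : p ∈ U) :
    scalarCurv (ppMetric H) p = 0 := by
  simp [scalarCurv, ricci_ppMetric hU hH _ _ hp, ppMetric_inv, Fin.sum_univ_four]

/-- The component `(i, j, k, l)` of minus one half of the Kulkarni–Nomizu product of
`du ⊗ du` and `c`, for symmetric `c` that vanish on `∂ᵤ`. -/
def duKulkarniNomizu (c : Matrix (Fin 4) (Fin 4) ℝ) (i j k l : Fin 4) : ℝ :=
  1 / 2 * ((if k = 0 then (if j = 0 then c i l else 0) - (if i = 0 then c j l else 0) else 0)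
    - if l = 0 then (if j = 0 then c i k else 0) - (if i = 0 then c j k else 0) else 0)

/-- The diagonal trace-free symmetric form in the `x`-plane. -/
def diagForm : Matrix (Fin 4) (Fin 4) ℝ :=
  !![0, 0, 0, 0; 0, 0, 0, 0; 0, 0, 1 / 2, 0; 0, 0, 0, -(1 / 2)]

/-- The off-diagonal symmetric form in the `x`-plane. -/
def offDiagForm : Matrix (Fin 4) (Fin 4) ℝ :=
  !![0, 0, 0, 0; 0, 0, 0, 0; 0, 0, 0, 1; 0, 0, 1, 0]

/-- `∂₁²H - ∂₂²H`. -/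
def shearDiag (H : ℝ → ℝ → ℝ → ℝ) (p : Pt) : ℝ :=
  pd 2 (pd 2 (lift H)) p - pd 3 (pd 3 (lift H)) p

/-- `∂₁∂₂H`. -/
def shearOff (H : ℝ → ℝ → ℝ → ℝ) : Pt → ℝ := pd 2 (pd 3 (lift H))

-- The Ricci terms remove the trace of the $x$-Hessian of $H$. The trace-free remainder has two
-- components, and the constant coefficients separate them from the index bookkeeping.
set_option maxHeartbeats 4000000 in
theorem weyl_ppMetric {H : ℝ → ℝ → ℝ → ℝ} {U : Set Pt} (hU : IsOpen U)
    (hH : ContDiffOn ℝ ∞ (lift H) U) (i j k l : Fin 4) {p : Pt} (hp : p ∈ U) :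
    weyl (ppMetric H) i j k l p =
      duKulkarniNomizu diagForm i j k l * shearDiag H p
        + duKulkarniNomizu offDiagForm i j k l * shearOff H p := by
  have h02 := pd_comm hU hH 0 2 hp
  have h03 := pd_comm hU hH 0 3 hp
  have h23 := pd_comm hU hH 2 3 hp
  simp only [weyl, riemann_ppMetric hU hH _ _ _ _ hp, ricci_ppMetric hU hH _ _ hp,
    scalarCurv_ppMetric hU hH hp, lapX, shearDiag, shearOff, duKulkarniNomizu]
  fin_cases i <;> fin_cases j <;> fin_cases k <;> fin_cases l <;>
    simp [ppMetric, diagForm, offDiagForm] <;> linarith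

theorem contDiffOn_shearDiag {H : ℝ → ℝ → ℝ → ℝ} {U : Set Pt} (hU : IsOpen U)
    (hH : ContDiffOn ℝ ∞ (lift H) U) : ContDiffOn ℝ ∞ (shearDiag H) U :=
  (contDiffOn_pd hU (contDiffOn_pd hU hH 2) 2).sub (contDiffOn_pd hU (contDiffOn_pd hU hH 3) 3)

theorem contDiffOn_shearOff {H : ℝ → ℝ → ℝ → ℝ} {U : Set Pt} (hU : IsOpen U)
    (hH : ContDiffOn ℝ ∞ (lift H) U) : ContDiffOn ℝ ∞ (shearOff H) U :=
  contDiffOn_pd hU (contDiffOn_pd hU hH 3) 2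

theorem contDiffOn_lapX {H : ℝ → ℝ → ℝ → ℝ} {U : Set Pt} (hU : IsOpen U)
    (hH : ContDiffOn ℝ ∞ (lift H) U) : ContDiffOn ℝ ∞ (lapX H) U :=
  (contDiffOn_pd hU (contDiffOn_pd hU hH 2) 2).add (contDiffOn_pd hU (contDiffOn_pd hU hH 3) 3)

theorem pd_weyl_ppMetric {H : ℝ → ℝ → ℝ → ℝ} {U : Set Pt} (hU : IsOpen U)
    (hH : ContDiffOn ℝ ∞ (lift H) U) (m i j k l : Fin 4) {p : Pt} (hp : p ∈ U) :
    pd m (weyl (ppMetric H) i j k l) p =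
      duKulkarniNomizu diagForm i j k l * pd m (shearDiag H) p
        + duKulkarniNomizu offDiagForm i j k l * pd m (shearOff H) p := by
  have h1 := ContDiffOn.differentiableAt_of_isOpen hU (contDiffOn_shearDiag hU hH) hp
  have h2 := ContDiffOn.differentiableAt_of_isOpen hU (contDiffOn_shearOff hU hH) hp
  rw [pd_congr hU (fun q hq => weyl_ppMetric hU hH i j k l hq) m hp,
    pd_add (h1.const_mul _) (h2.const_mul _), pd_const_mul, pd_const_mul]

theorem pd_one_lapX (H : ℝ → ℝ → ℝ → ℝ) (p : Pt) : pd 1 (lapX H) p = 0 := by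
  refine pd_eq_zero_of_invariant (fun q t => ?_) p
  simp only [lapX, pd_add_single (pd_add_single (lift_add_single H) _)]

theorem pd_one_shearDiag (H : ℝ → ℝ → ℝ → ℝ) (p : Pt) : pd 1 (shearDiag H) p = 0 := by
  refine pd_eq_zero_of_invariant (fun q t => ?_) p
  simp only [shearDiag, pd_add_single (pd_add_single (lift_add_single H) _)]

theorem pd_one_shearOff (H : ℝ → ℝ → ℝ → ℝ) (p : Pt) : pd 1 (shearOff H) p = 0 :=
  pd_one_pd_pd_lift H 2 3 p

/-- This is the step that turns the divergence of the trace-free Hessian into the gradient of its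
trace; only symmetry of third derivatives enters. -/
theorem pd_lapX_eq {H : ℝ → ℝ → ℝ → ℝ} {U : Set Pt} (hU : IsOpen U)
    (hH : ContDiffOn ℝ ∞ (lift H) U) {p : Pt} (hp : p ∈ U) :
    pd 2 (lapX H) p = pd 2 (shearDiag H) p + 2 * pd 3 (shearOff H) p ∧
      pd 3 (lapX H) p = -pd 3 (shearDiag H) p + 2 * pd 2 (shearOff H) p := by
  have hd : ∀ i, DifferentiableAt ℝ (pd i (pd i (lift H))) p := fun i =>
    ContDiffOn.differentiableAt_of_isOpen hU (contDiffOn_pd hU (contDiffOn_pd hU hH i) i) hp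
  have h1 : ∀ i, pd i (lapX H) p = pd i (pd 2 (pd 2 (lift H))) p + pd i (pd 3 (pd 3 (lift H))) p :=
    fun i => pd_add (hd 2) (hd 3) i
  have h2 : ∀ i, pd i (shearDiag H) p
      = pd i (pd 2 (pd 2 (lift H))) p - pd i (pd 3 (pd 3 (lift H))) p :=
    fun i => pd_sub (hd 2) (hd 3) i
  have h3 : pd 3 (shearOff H) p = pd 2 (pd 3 (pd 3 (lift H))) p :=
    pd_comm hU (contDiffOn_pd hU hH 3) 3 2 hp
  have h4 : pd 2 (shearOff H) p = pd 3 (pd 2 (pd 2 (lift H))) p := by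
    rw [← pd_comm hU (contDiffOn_pd hU hH 2) 2 3 hp]
    exact pd_congr hU (fun q hq => pd_comm hU hH 2 3 hq) 2 hp
  simp only [h1, h2, h3, h4]
  constructor <;> ring

set_option maxHeartbeats 4000000 in
theorem divWeyl_ppMetric {H : ℝ → ℝ → ℝ → ℝ} {U : Set Pt} (hU : IsOpen U)
    (hH : ContDiffOn ℝ ∞ (lift H) U) (i j k : Fin 4) {p : Pt} (hp : p ∈ U) :
    divWeyl (ppMetric H) i j k p = if k = 0 then
      1 / 4 * ((if j = 0 ∧ i ≠ 0 then pd i (lapX H) p else 0)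
        - if i = 0 ∧ j ≠ 0 then pd j (lapX H) p else 0) else 0 := by
  obtain ⟨h2, h3⟩ := pd_lapX_eq hU hH hp
  have h1 := pd_one_lapX H p
  have h4 := pd_one_shearDiag H p
  have h5 := pd_one_shearOff H p
  have hdiv : divWeyl (ppMetric H) i j k p = covDeriv (ppMetric H) (weyl (ppMetric H)) 0 i j k 1 p
      + (covDeriv (ppMetric H) (weyl (ppMetric H)) 1 i j k 0 p
        - lift H p * covDeriv (ppMetric H) (weyl (ppMetric H)) 1 i j k 1 p)
      + covDeriv (ppMetric H) (weyl (ppMetric H)) 2 i j k 2 p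
      + covDeriv (ppMetric H) (weyl (ppMetric H)) 3 i j k 3 p := by
    simp [divWeyl, ppMetric_inv, Fin.sum_univ_four, sub_eq_add_neg]
  simp only [hdiv, covDeriv, pd_weyl_ppMetric hU hH _ _ _ _ _ hp, weyl_ppMetric hU hH _ _ _ _ hp,
    christoffel_ppMetric, Fin.sum_univ_four]
  fin_cases i <;> fin_cases j <;> fin_cases k <;>
    simp [duKulkarniNomizu, diagForm, offDiagForm, h1, h2, h3, h4, h5] <;> ring

theorem harmonicWeyl_ppMetric_iff {H : ℝ → ℝ → ℝ → ℝ} {U : Set Pt} (hU : IsOpen U)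
    (hH : ContDiffOn ℝ ∞ (lift H) U) :
    HarmonicWeyl (ppMetric H) U ↔ ∀ p ∈ U, ∀ i : Fin 4, i ≠ 0 → pd i (lapX H) p = 0 := by
  refine forall₂_congr fun p hp => ⟨fun h i hi => ?_, fun h i j k => ?_⟩
  · have := h i 0 0
    rw [divWeyl_ppMetric hU hH i 0 0 hp] at this
    simpa [hi] using this
  · rw [divWeyl_ppMetric hU hH i j k hp]
    simp +contextual [h]

/-! ### Functions of `u` -/

/-- A function with vanishing `v`- and `x`-derivatives is locally a function of `u`. -/
theorem locallyFunctionOfU_of_pd_eq_zero {F : Pt → ℝ} {U : Set Pt} (hU : IsOpen U)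
    (hF : ContDiffOn ℝ ∞ F U) (h : ∀ p ∈ U, ∀ i : Fin 4, i ≠ 0 → pd i F p = 0) :
    LocallyFunctionOfU F U := by
  intro p hp
  obtain ⟨r, hr, hrU⟩ := Metric.isOpen_iff.1 hU p hp
  -- Balls for the sup norm are boxes, so moving `q` within its slice to the line through `p` in
  -- direction $u$ stays inside the ball.
  refine ⟨Metric.ball p r, Metric.isOpen_ball, Metric.mem_ball_self hr, hrU,
    fun t => F (Function.update p 0 t), fun q hq => ?_⟩
  have hq' : Function.update p 0 (q 0) ∈ Metric.ball p r := by
    rw [Metric.mem_ball, dist_pi_lt_iff hr] at hq ⊢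
    intro i
    by_cases hi : i = 0
    · subst hi; simpa using hq 0
    · simpa [hi] using hr
  set d : Pt := Function.update p 0 (q 0) - q with hd
  have hmem : ∀ t ∈ Set.Icc (0 : ℝ) 1, q + t • d ∈ U := fun t ht => hrU <| by
    have := (convex_ball p r).add_smul_sub_mem hq hq' ht
    simpa [hd] using this
  have hderiv : ∀ t ∈ Set.Icc (0 : ℝ) 1, HasDerivAt (fun s : ℝ => F (q + s • d)) 0 t := by
    intro t ht
    have h1 := (ContDiffOn.differentiableAt_of_isOpen hU hF (hmem t ht)).hasFDerivAt
    have h2 : HasDerivAt (fun s : ℝ => q + s • d) d t := by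
      simpa using ((hasDerivAt_id t).smul_const d).const_add q
    have h3 := h1.comp_hasDerivAt t h2
    rw [fderiv_apply_eq_sum_pd] at h3
    have hz : ∑ i, d i * pd i F (q + t • d) = 0 := by
      refine Finset.sum_eq_zero fun i _ => ?_
      by_cases hi : i = 0
      · subst hi; simp [hd]
      · rw [h _ (hmem t ht) i hi, mul_zero]
    rw [hz] at h3
    exact h3
  have := constant_of_has_deriv_right_zero
    (fun t ht => (hderiv t ht).continuousAt.continuousWithinAt)
    (fun t ht => (hderiv t ⟨ht.1, ht.2.le⟩).hasDerivWithinAt) 1 (by simp)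
  simpa [hd] using this.symm

theorem update_zero_mem_nhds {N : Set Pt} (hN : IsOpen N) {q : Pt} (hq : q ∈ N) :
    ∀ᶠ t in 𝓝 (q 0), Function.update q 0 t ∈ N := by
  have hc : Continuous fun t : ℝ => (Function.update q 0 t : Pt) :=
    continuous_const.update 0 continuous_id
  exact hc.continuousAt.eventually (hN.mem_nhds (by simpa using hq))

/-- The function `φ` is only prescribed on the values of $u$ taken on `N`. Reading it off along a
$u$-line lets it inherit regularity and derivatives from `F`. -/
theorem eventuallyEq_update_of_eq {F : Pt → ℝ} {N : Set Pt} {φ : ℝ → ℝ} (hN : IsOpen N)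
    (h : ∀ q ∈ N, F q = φ (q 0)) {q : Pt} (hq : q ∈ N) :
    φ =ᶠ[𝓝 (q 0)] fun t => F (Function.update q 0 t) := by
  filter_upwards [update_zero_mem_nhds hN hq] with t ht
  simpa using (h _ ht).symm

theorem contDiffAt_of_eq_comp {F : Pt → ℝ} {N : Set Pt} {φ : ℝ → ℝ} (hN : IsOpen N)
    (hF : ContDiffOn ℝ ∞ F N) (h : ∀ q ∈ N, F q = φ (q 0)) {q : Pt} (hq : q ∈ N) :
    ContDiffAt ℝ ∞ φ (q 0) := by
  refine ContDiffAt.congr_of_eventuallyEq ?_ (eventuallyEq_update_of_eq hN h hq)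
  have h1 : ContDiffAt ℝ ∞ F (Function.update q 0 (q 0)) := by
    rw [Function.update_eq_self]; exact hF.contDiffAt (hN.mem_nhds hq)
  exact h1.comp (q 0) (contDiff_update ∞ q 0).contDiffAt

theorem deriv_eq_pd_zero {F : Pt → ℝ} {N : Set Pt} {φ : ℝ → ℝ} (hN : IsOpen N)
    (hF : ContDiffOn ℝ ∞ F N) (h : ∀ q ∈ N, F q = φ (q 0)) {q : Pt} (hq : q ∈ N) :
    pd 0 F q = deriv φ (q 0) := by
  have h1 : HasFDerivAt F (fderiv ℝ F q) (Function.update q 0 (q 0)) := by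
    rw [Function.update_eq_self]
    exact (ContDiffOn.differentiableAt_of_isOpen hN hF hq).hasFDerivAt
  have h2 := h1.comp_hasDerivAt (q 0) (hasDerivAt_update q 0 (q 0))
  exact ((h2.congr_of_eventuallyEq (eventuallyEq_update_of_eq hN h hq)).deriv).symm

theorem pd_comp_zero (φ : ℝ → ℝ) {q : Pt} (hφ : DifferentiableAt ℝ φ (q 0)) (i : Fin 4) :
    pd i (fun p => φ (p 0)) q = if i = 0 then deriv φ (q 0) else 0 := by
  have h1 : HasFDerivAt (fun p : Pt => p 0) (ContinuousLinearMap.proj 0) q :=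
    (ContinuousLinearMap.proj (R := ℝ) (φ := fun _ : Fin 4 => ℝ) 0).hasFDerivAt
  have h2 := hφ.hasDerivAt.comp_hasFDerivAt q h1
  have h3 : fderiv ℝ (fun p : Pt => φ (p 0)) q = _ := h2.fderiv
  rw [pd, h3]
  by_cases hi : i = 0
  · subst hi; simp
  · simp [hi, Ne.symm hi]

/-- A locally `u`-dependent function on a set with connected slices is a function of `u`. -/
theorem LocallyFunctionOfU.functionOfU {F : Pt → ℝ} {U : Set Pt}
    (h : LocallyFunctionOfU F U) (hs : ConnectedSlices U) : FunctionOfU F U := by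
  classical
  have key : ∀ p ∈ U, ∀ q ∈ U, p 0 = q 0 → F p = F q := by
    intro p hp q hq hpq
    have hcont : IsLocallyConstant fun x : {x : Pt | x ∈ U ∧ x 0 = q 0} => F x := by
      rw [IsLocallyConstant.iff_eventually_eq]
      intro x
      obtain ⟨N, hN, hxN, -, φ, hφ⟩ := h x x.2.1
      filter_upwards [continuous_subtype_val.continuousAt.eventually (hN.mem_nhds hxN)] with y hy
      rw [hφ _ hy, hφ _ hxN, y.2.2, x.2.2]
    have : PreconnectedSpace {x : Pt | x ∈ U ∧ x 0 = q 0} :=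
      isPreconnected_iff_preconnectedSpace.1 (hs (q 0))
    exact hcont.apply_eq_of_preconnectedSpace ⟨p, hp, hpq⟩ ⟨q, hq, rfl⟩
  -- The value is read at a chosen point of the slice; over empty slices it is set to `0`.
  refine ⟨fun t => if ht : ∃ q ∈ U, q 0 = t then F ht.choose else 0, fun p hp => ?_⟩
  have ht : ∃ q ∈ U, q 0 = p 0 := ⟨p, hp, rfl⟩
  simp only [dif_pos ht]
  exact key p hp _ ht.choose_spec.1 ht.choose_spec.2.symm

theorem FunctionOfU.locally {F : Pt → ℝ} {U : Set Pt} (hU : IsOpen U) (h : FunctionOfU F U) :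
    LocallyFunctionOfU F U := fun _ hp => ⟨U, hU, hp, subset_rfl, h⟩

theorem LocallyFunctionOfU.pd_eq_zero {F : Pt → ℝ} {U : Set Pt}
    (hF : ContDiffOn ℝ ∞ F U) (h : LocallyFunctionOfU F U) {p : Pt} (hp : p ∈ U) {i : Fin 4}
    (hi : i ≠ 0) : pd i F p = 0 := by
  obtain ⟨N, hN, hpN, hNU, φ, hφ⟩ := h p hp
  rw [pd_congr hN hφ i hpN, pd_comp_zero φ, if_neg hi]
  exact (contDiffAt_of_eq_comp hN (hF.mono hNU) hφ hpN).differentiableAt (by simp)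

/-! ### A Riccati equation -/

/-- Local solvability of `ψ'' = μ ψ'² + k` with `ψ' = 1` at the initial time. -/
theorem exists_solution_riccati (μ : ℝ) {k : ℝ → ℝ} {t₀ : ℝ} {s : Set ℝ} (hs : s ∈ 𝓝 t₀)
    (hk : ContDiffOn ℝ ∞ k s) :
    ∃ ψ : ℝ → ℝ, ∃ ε > (0 : ℝ), Set.Ioo (t₀ - ε) (t₀ + ε) ⊆ s ∧
      ContDiffOn ℝ ∞ ψ (Set.Ioo (t₀ - ε) (t₀ + ε)) ∧
      ∀ t ∈ Set.Ioo (t₀ - ε) (t₀ + ε), deriv ψ t ≠ 0 ∧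
        deriv (deriv ψ) t = μ * deriv ψ t ^ 2 + k t := by
  obtain ⟨r, hr, hrs⟩ := Metric.mem_nhds_iff.1 hs
  have hk₀ : ContDiffAt ℝ 1 k t₀ := (hk.contDiffAt hs).of_le (by simp)
  -- The equation becomes an autonomous first-order system for $(t,\psi',\psi)$ with initial value
  -- $(t_0,1,0)$.
  have hX : ContDiffAt ℝ 1
      (fun z : ℝ × ℝ × ℝ => ((1 : ℝ), μ * z.2.1 ^ 2 + k z.1, z.2.1)) (t₀, 1, 0) := by
    have h1 : ContDiffAt ℝ 1 (fun z : ℝ × ℝ × ℝ => k z.1) (t₀, 1, 0) :=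
      ContDiffAt.comp (t₀, (1 : ℝ), (0 : ℝ)) (g := k) (f := Prod.fst) hk₀ contDiffAt_fst
    have h2 : ContDiffAt ℝ 1 (fun z : ℝ × ℝ × ℝ => z.2.1) (t₀, 1, 0) := by fun_prop
    exact contDiffAt_const.prodMk (((contDiffAt_const.mul (h2.pow 2)).add h1).prodMk h2)
  obtain ⟨α, hα₀, ε, hε, hα⟩ :=
    hX.exists_forall_mem_closedBall_exists_eq_forall_mem_Ioo_hasDerivAt₀ t₀
  have hα1 : ∀ t ∈ Set.Ioo (t₀ - ε) (t₀ + ε), HasDerivAt (fun t => (α t).1) 1 t :=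
    fun t ht => (ContinuousLinearMap.fst ℝ ℝ (ℝ × ℝ)).hasFDerivAt.comp_hasDerivAt t (hα t ht)
  have hα2 : ∀ t ∈ Set.Ioo (t₀ - ε) (t₀ + ε),
      HasDerivAt (fun t => (α t).2.1) (μ * (α t).2.1 ^ 2 + k (α t).1) t := fun t ht =>
    ((ContinuousLinearMap.fst ℝ ℝ ℝ).comp
      (ContinuousLinearMap.snd ℝ ℝ (ℝ × ℝ))).hasFDerivAt.comp_hasDerivAt t (hα t ht)
  have hα3 : ∀ t ∈ Set.Ioo (t₀ - ε) (t₀ + ε), HasDerivAt (fun t => (α t).2.2) (α t).2.1 t :=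
    fun t ht => ((ContinuousLinearMap.snd ℝ ℝ ℝ).comp
      (ContinuousLinearMap.snd ℝ ℝ (ℝ × ℝ))).hasFDerivAt.comp_hasDerivAt t (hα t ht)
  have hy_cont : ContinuousAt (fun t => (α t).2.1) t₀ :=
    (hα2 t₀ ⟨by linarith, by linarith⟩).continuousAt
  have hy_ne : ∀ᶠ t in 𝓝 t₀, (α t).2.1 ≠ 0 := hy_cont.eventually_ne (by simp [hα₀])
  obtain ⟨r', hr', hr'y⟩ := Metric.eventually_nhds_iff_ball.1 hy_ne
  -- The three radii secure existence of the solution, containment in `s`, and $\psi'\ne0$.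
  set δ := min ε (min r r') with hδ
  have hδ₀ : 0 < δ := lt_min hε (lt_min hr hr')
  set I := Set.Ioo (t₀ - δ) (t₀ + δ) with hI
  have hIo : IsOpen I := isOpen_Ioo
  have hIs : I ⊆ s := by
    rw [hI, ← Real.ball_eq_Ioo]
    exact (Metric.ball_subset_ball ((min_le_right _ _).trans (min_le_left _ _))).trans hrs
  have hIε : I ⊆ Set.Ioo (t₀ - ε) (t₀ + ε) := by
    rw [hI, ← Real.ball_eq_Ioo, ← Real.ball_eq_Ioo]
    exact Metric.ball_subset_ball (min_le_left _ _)
  have hIy : ∀ t ∈ I, (α t).2.1 ≠ 0 := by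
    intro t ht
    rw [hI, ← Real.ball_eq_Ioo] at ht
    exact hr'y t (Metric.ball_subset_ball ((min_le_right _ _).trans (min_le_right _ _)) ht)
  have ht₀ : t₀ ∈ I := ⟨by linarith, by linarith⟩
  have htime : ∀ t ∈ I, (α t).1 = t := by
    have hd : ∀ t ∈ I, HasDerivAt (fun t => (α t).1 - t) 0 t := fun t ht => by
      simpa using (hα1 t (hIε ht)).fun_sub (hasDerivAt_id' t)
    intro t ht
    have := hIo.is_const_of_deriv_eq_zero (isPreconnected_Ioo)
      (fun x hx => (hd x hx).differentiableAt.differentiableWithinAt)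
      (fun x hx => (hd x hx).deriv) ht ht₀
    simp only [hα₀] at this
    linarith
  have hy : ∀ t ∈ I, HasDerivAt (fun t => (α t).2.1) (μ * (α t).2.1 ^ 2 + k t) t := fun t ht => by
    simpa [htime t ht] using hα2 t (hIε ht)
  have hψ : ∀ t ∈ I, HasDerivAt (fun t => (α t).2.2) (α t).2.1 t := fun t ht =>
    hα3 t (hIε ht)
  -- Bootstrapping: the right-hand side of the equation is as regular as $\psi'$, so $\psi'$ gains
  -- one derivative at each stage.
  have hysmooth : ContDiffOn ℝ ∞ (fun t => (α t).2.1) I := by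
    rw [contDiffOn_infty]
    intro n
    induction n with
    | zero => exact contDiffOn_zero.2 fun t ht => (hy t ht).continuousAt.continuousWithinAt
    | succ n ih =>
      rw [Nat.cast_succ, contDiffOn_succ_iff_deriv_of_isOpen hIo]
      refine ⟨fun t ht => (hy t ht).differentiableAt.differentiableWithinAt, by simp, ?_⟩
      refine ((contDiffOn_const.mul (ih.pow 2)).add ((hk.mono hIs).of_le ?_)).congr
        fun t ht => (hy t ht).deriv
      exact WithTop.coe_le_coe.2 le_top
  refine ⟨fun t => (α t).2.2, δ, hδ₀, hIs, ?_, fun t ht => ⟨?_, ?_⟩⟩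
  · rw [contDiffOn_infty_iff_deriv_of_isOpen hIo]
    exact ⟨fun t ht => (hψ t ht).differentiableAt.differentiableWithinAt,
      hysmooth.congr fun t ht => (hψ t ht).deriv⟩
  · rw [(hψ t ht).deriv]; exact hIy t ht
  · have : deriv (fun t => (α t).2.2) =ᶠ[𝓝 t] fun t => (α t).2.1 :=
      Filter.eventually_of_mem (hIo.mem_nhds ht) fun x hx => (hψ x hx).deriv
    rw [this.deriv_eq, (hψ t ht).deriv, (hy t ht).deriv]

/-! ### Isotropic quasi-Einstein potentials -/

theorem hess_ppMetric (H : ℝ → ℝ → ℝ → ℝ) (f : Pt → ℝ) (i j : Fin 4) (p : Pt) :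
    hess (ppMetric H) f i j p = pd i (pd j f) p - 1 / 2 *
      ((if j = 0 then pd i (lift H) p * pd 1 f p else 0)
        + (if i = 0 ∧ j ≠ 0 then pd j (lift H) p * pd 1 f p else 0)
        - (if i = 0 ∧ j = 0 then
            pd 2 (lift H) p * pd 2 f p + pd 3 (lift H) p * pd 3 f p else 0)) := by
  simp only [hess, christoffel_ppMetric, Fin.sum_univ_four]
  fin_cases i <;> fin_cases j <;> simp <;> ring

theorem grad_ppMetric (H : ℝ → ℝ → ℝ → ℝ) (f : Pt → ℝ) (p : Pt) :
    grad (ppMetric H) f p = ![pd 1 f p, pd 0 f p - lift H p * pd 1 f p, pd 2 f p, pd 3 f p] := by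
  funext i
  fin_cases i <;> simp [grad, ppMetric_inv, Fin.sum_univ_four]
  ring

theorem lightlike_grad_ppMetric_iff (H : ℝ → ℝ → ℝ → ℝ) (f : Pt → ℝ) (p : Pt) :
    Lightlike (ppMetric H) p (grad (ppMetric H) f p) ↔ (∃ i, pd i f p ≠ 0) ∧
      2 * (pd 0 f p * pd 1 f p) - lift H p * (pd 1 f p * pd 1 f p) + pd 2 f p * pd 2 f p
        + pd 3 f p * pd 3 f p = 0 := by
  rw [Lightlike, grad_ppMetric]
  refine and_congr ?_ ?_
  · rw [not_iff_comm]
    push Not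
    constructor
    · intro h
      funext i
      fin_cases i <;> simp [h]
    · intro h
      have h0 := congrFun h 0
      have h1 := congrFun h 1
      have h2 := congrFun h 2
      have h3 := congrFun h 3
      simp at h0 h1 h2 h3
      rw [h0] at h1
      intro i
      fin_cases i <;> simp_all
  · have : ∀ x : ℝ, ∀ y : ℝ, x = y → (x = 0 ↔ y = 0) := fun x y h => by rw [h]
    apply this
    simp [ppMetric, Fin.sum_univ_four]
    ring

section Potential

variable {V : Set Pt} {H : ℝ → ℝ → ℝ → ℝ} {μ : ℝ} {f : Pt → ℝ}

/-- The derivative of `g(∇f, ∇f) = 0`. -/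
theorem IsotropicQE.pd_null (hV : IsOpen V) (hH : ContDiffOn ℝ ∞ (lift H) V)
    (hf : IsotropicQE (ppMetric H) V f μ) {p : Pt} (hp : p ∈ V) (i : Fin 4) :
    2 * (pd i (pd 0 f) p * pd 1 f p + pd 0 f p * pd i (pd 1 f) p)
      - (pd i (lift H) p * (pd 1 f p * pd 1 f p)
        + lift H p * (2 * pd 1 f p * pd i (pd 1 f) p))
      + 2 * pd 2 f p * pd i (pd 2 f) p + 2 * pd 3 f p * pd i (pd 3 f) p = 0 := by
  have hd : ∀ j, DifferentiableAt ℝ (pd j f) p := fun j =>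
    ContDiffOn.differentiableAt_of_isOpen hV (contDiffOn_pd hV hf.1.1 j) hp
  have hh := ContDiffOn.differentiableAt_of_isOpen hV hH hp
  have h0 := pd_congr hV (G := fun _ => 0)
    (fun q hq => ((lightlike_grad_ppMetric_iff H f q).1 (hf.2 q hq)).2) i hp
  have h01 := (hd 0).fun_mul (hd 1)
  have h11 := (hd 1).fun_mul (hd 1)
  have h22 := (hd 2).fun_mul (hd 2)
  have h33 := (hd 3).fun_mul (hd 3)
  have hh11 := hh.fun_mul h11
  rw [pd_add (((h01.const_mul 2).fun_sub hh11).fun_add h22) h33,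
    pd_add ((h01.const_mul 2).fun_sub hh11) h22, pd_sub (h01.const_mul 2) hh11, pd_const_mul,
    pd_mul hh h11, pd_mul (hd 0) (hd 1), pd_mul (hd 1) (hd 1), pd_mul (hd 2) (hd 2),
    pd_mul (hd 3) (hd 3), pd_const] at h0
  linarith

/-- The equations `Hes_f + ρ - μ df ⊗ df = 0`: the function `λ` vanishes identically. -/
theorem IsotropicQE.equations (hV : IsOpen V) (hH : ContDiffOn ℝ ∞ (lift H) V)
    (hf : IsotropicQE (ppMetric H) V f μ) {p : Pt} (hp : p ∈ V) :
    (∀ i, pd i (pd 1 f) p = μ * (pd 1 f p * pd i f p)) ∧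
    (∀ i j, i ≠ 0 → j ≠ 0 → pd i (pd j f) p = μ * (pd i f p * pd j f p)) ∧
    (∀ i, i ≠ 0 → pd i (pd 0 f) p = 1 / 2 * pd i (lift H) p * pd 1 f p
      + μ * (pd i f p * pd 0 f p)) ∧
    pd 0 (pd 0 f) p - 1 / 2 * (pd 0 (lift H) p * pd 1 f p - pd 2 (lift H) p * pd 2 f p
      - pd 3 (lift H) p * pd 3 f p) - 1 / 2 * lapX H p - μ * (pd 0 f p) ^ 2 = 0 := by
  obtain ⟨lam, hlam⟩ := hf.1.2
  obtain ⟨⟨i₀, hi₀⟩, hnull⟩ := (lightlike_grad_ppMetric_iff H f p).1 (hf.2 p hp)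
  have hdn := hf.pd_null hV hH hp
  have E := hlam p hp
  simp only [hess_ppMetric, ricci_ppMetric hV hH _ _ hp] at E
  have c := fun i j => pd_comm hV hf.1.1 i j hp
  have c10 := c 1 0
  have c20 := c 2 0
  have c30 := c 3 0
  have c21 := c 2 1
  have c31 := c 3 1
  have c32 := c 3 2
  have e00 := E 0 0
  have e01 := E 0 1
  have e02 := E 0 2
  have e03 := E 0 3
  have e11 := E 1 1
  have e12 := E 1 2
  have e13 := E 1 3
  have e22 := E 2 2
  have e23 := E 2 3
  have e33 := E 3 3
  have n0 := hdn 0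
  have n1 := hdn 1
  have n2 := hdn 2
  have n3 := hdn 3
  clear hdn c E
  simp [ppMetric] at e00 e01 e02 e03 e11 e12 e13 e22 e23 e33 n1
  have r01 : pd 0 (pd 1 f) p = lam p + μ * (pd 0 f p * pd 1 f p) := by linarith
  have r02 : pd 0 (pd 2 f) p = 1 / 2 * pd 2 (lift H) p * pd 1 f p + μ * (pd 0 f p * pd 2 f p) := by
    linarith
  have r03 : pd 0 (pd 3 f) p = 1 / 2 * pd 3 (lift H) p * pd 1 f p + μ * (pd 0 f p * pd 3 f p) := by
    linarith
  have r11 : pd 1 (pd 1 f) p = μ * (pd 1 f p * pd 1 f p) := by linarith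
  have r12 : pd 1 (pd 2 f) p = μ * (pd 1 f p * pd 2 f p) := by linarith
  have r13 : pd 1 (pd 3 f) p = μ * (pd 1 f p * pd 3 f p) := by linarith
  have r22 : pd 2 (pd 2 f) p = lam p + μ * (pd 2 f p * pd 2 f p) := by linarith
  have r23 : pd 2 (pd 3 f) p = μ * (pd 2 f p * pd 3 f p) := by linarith
  have r33 : pd 3 (pd 3 f) p = lam p + μ * (pd 3 f p * pd 3 f p) := by linarith
  rw [c10, r01, r11, r12, r13] at n1
  rw [c20, c21, r02, r12, r22, r23] at n2
  rw [c30, c31, c32, r03, r13, r23, r33] at n3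
  rw [r01, r02, r03] at n0
  -- Half the derivative of $|\nabla f|^2=0$ is $\operatorname{Hes}_f(\nabla f,\cdot)=0$, and
  -- nullity removes the $\mu$-term. What remains is $\lambda\,df=\rho(\nabla
  -- f,\cdot)=-\frac12\Delta_xH\,f_v\,du$, component by component.
  have a1 : lam p * pd 1 f p = 0 := by
    linear_combination n1 / 2 - μ * pd 1 f p * hnull
  have a2 : lam p * pd 2 f p = 0 := by
    linear_combination n2 / 2 - μ * pd 2 f p * hnull
  have a3 : lam p * pd 3 f p = 0 := by
    linear_combination n3 / 2 - μ * pd 3 f p * hnull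
  have a0 : lam p * pd 0 f p = -(1 / 2) * lapX H p * pd 1 f p := by
    linear_combination n0 / 2 - pd 1 f p * e00 - μ * pd 0 f p * hnull
  have hl : lam p = 0 := by
    by_contra hne
    have b1 : pd 1 f p = 0 := (mul_eq_zero.1 a1).resolve_left hne
    have b2 : pd 2 f p = 0 := (mul_eq_zero.1 a2).resolve_left hne
    have b3 : pd 3 f p = 0 := (mul_eq_zero.1 a3).resolve_left hne
    rw [b1, mul_zero] at a0
    have b0 : pd 0 f p = 0 := (mul_eq_zero.1 a0).resolve_left hne
    apply hi₀
    fin_cases i₀ <;> assumption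
  simp only [hl, zero_add, zero_mul] at r01 r22 r33 e00
  refine ⟨fun i => ?_, fun i j hi hj => ?_, fun i hi => ?_, by linarith⟩
  · fin_cases i <;> simp only [Fin.zero_eta, Fin.mk_one, Fin.reduceFinMk, c21, c31, r01, r11, r12,
      r13] <;> ring
  · fin_cases i <;> fin_cases j <;>
      first
      | exact absurd rfl hi
      | exact absurd rfl hj
      | simp only [Fin.mk_one, Fin.reduceFinMk, c21, c31, c32, r11, r12, r13, r22, r23, r33] <;>
          ring
  · fin_cases i <;>
      first
      | exact absurd rfl hi
      | simp only [Fin.mk_one, Fin.reduceFinMk, c10, c20, c30, r01, r02, r03, pd_one_lift] <;> ring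

/-- If `f_v` vanishes somewhere on a connected open set then it vanishes identically, since
`d f_v = μ f_v df`. -/
theorem IsotropicQE.pd_one_eq_zero (hV : IsOpen V) (hVc : IsPreconnected V)
    (hH : ContDiffOn ℝ ∞ (lift H) V) (hf : IsotropicQE (ppMetric H) V f μ) {p q : Pt}
    (hp : p ∈ V) (hq : q ∈ V) (h : pd 1 f p = 0) : pd 1 f q = 0 := by
  have hfd : ∀ x ∈ V, DifferentiableAt ℝ f x := fun x hx =>
    ContDiffOn.differentiableAt_of_isOpen hV hf.1.1 hx
  have hfd1 : ∀ x ∈ V, DifferentiableAt ℝ (pd 1 f) x := fun x hx =>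
    ContDiffOn.differentiableAt_of_isOpen hV (contDiffOn_pd hV hf.1.1 1) hx
  -- The integrating factor $e^{-\mu f}$ makes $f_ve^{-\mu f}$ constant.
  have he : ∀ x ∈ V, HasFDerivAt (fun y => Real.exp (-μ * f y))
      (Real.exp (-μ * f x) • ((-μ) • fderiv ℝ f x)) x := fun x hx =>
    ((hfd x hx).hasFDerivAt.const_mul (-μ)).exp
  have hg : ∀ x ∈ V, HasFDerivAt (fun y => pd 1 f y * Real.exp (-μ * f y))
      (0 : Pt →L[ℝ] ℝ) x := by
    intro x hx
    have hm := (hfd1 x hx).hasFDerivAt.fun_mul (he x hx)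
    refine hm.congr_fderiv ?_
    ext d
    have hd1 := fderiv_apply_eq_sum_pd (pd 1 f) x d
    have hd := fderiv_apply_eq_sum_pd f x d
    simp only [(hf.equations hV hH hx).1] at hd1
    have : fderiv ℝ (pd 1 f) x d = μ * pd 1 f x * fderiv ℝ f x d := by
      rw [hd, hd1, Finset.mul_sum]
      exact Finset.sum_congr rfl fun i _ => by ring
    simp [this]
    ring
  have := hV.is_const_of_fderiv_eq_zero (𝕜 := ℝ) hVc
    (fun x hx => (hg x hx).differentiableAt.differentiableWithinAt)
    (fun x hx => (hg x hx).fderiv) hq hp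
  simp only [h, zero_mul] at this
  exact (mul_eq_zero.1 this).resolve_right (Real.exp_ne_zero _)

/-- Where `f_v` does not vanish, `H` is affine in `x`. -/
theorem IsotropicQE.pd_pd_lift_eq_zero (hV : IsOpen V)
    (hH : ContDiffOn ℝ ∞ (lift H) V) (hf : IsotropicQE (ppMetric H) V f μ) {p : Pt}
    (hp : p ∈ V) (h : pd 1 f p ≠ 0) {i j : Fin 4} (hi : i ≠ 0) (hj : j ≠ 0) :
    pd i (pd j (lift H)) p = 0 := by
  have hd : ∀ j, DifferentiableAt ℝ (pd j f) p := fun j =>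
    ContDiffOn.differentiableAt_of_isOpen hV (contDiffOn_pd hV hf.1.1 j) hp
  have hhd : DifferentiableAt ℝ (pd j (lift H)) p :=
    ContDiffOn.differentiableAt_of_isOpen hV (contDiffOn_pd hV hH j) hp
  obtain ⟨e1, e2, e3, -⟩ := hf.equations hV hH hp
  -- The derivative $\partial_i\partial_j\partial_uf$ is computed from the $(j,u)$ equation and
  -- again from the $(i,j)$ equation. All terms with $\mu$ cancel and $\frac12 H_{ij}f_v=0$ is left.
  have h1 : pd i (pd j (pd 0 f)) p = 1 / 2 * (pd i (pd j (lift H)) p * pd 1 f p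
      + pd j (lift H) p * pd i (pd 1 f) p)
      + μ * (pd i (pd j f) p * pd 0 f p + pd j f p * pd i (pd 0 f) p) := by
    rw [pd_congr hV (fun q hq => (hf.equations hV hH hq).2.2.1 j hj) i hp,
      pd_add ((hhd.const_mul _).fun_mul (hd 1)) (((hd j).fun_mul (hd 0)).const_mul _),
      pd_const_mul, pd_mul (hhd.const_mul _) (hd 1), pd_mul (hd j) (hd 0), pd_const_mul]
    ring
  have h2 : pd i (pd j (pd 0 f)) p
      = μ * (pd 0 (pd i f) p * pd j f p + pd i f p * pd 0 (pd j f) p) := by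
    rw [pd_congr hV (fun q hq => pd_comm hV hf.1.1 j 0 hq) i hp,
      pd_comm hV (contDiffOn_pd hV hf.1.1 j) i 0 hp,
      pd_congr hV (fun q hq => (hf.equations hV hH hq).2.1 i j hi hj) 0 hp,
      pd_const_mul, pd_mul (hd i) (hd j)]
  rw [pd_comm hV hf.1.1 0 i hp, pd_comm hV hf.1.1 0 j hp, h1, e1, e2 i j hi hj, e3 i hi,
    e3 j hj] at h2
  have h3 : pd i (pd j (lift H)) p * pd 1 f p = 0 := by linear_combination 2 * h2
  exact (mul_eq_zero.1 h3).resolve_right h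

/-- If `f_v = 0` then `f` depends on `u` only. -/
theorem IsotropicQE.pd_eq_zero (hf : IsotropicQE (ppMetric H) V f μ) {p : Pt} (hp : p ∈ V)
    (h : pd 1 f p = 0) {i : Fin 4} (hi : i ≠ 0) : pd i f p = 0 := by
  have hn := ((lightlike_grad_ppMetric_iff H f p).1 (hf.2 p hp)).2
  rw [h] at hn
  -- Nullity has become $f_{x_1}^2+f_{x_2}^2=0$.
  have h2 : pd 2 f p = 0 := by nlinarith [mul_self_nonneg (pd 2 f p), mul_self_nonneg (pd 3 f p)]
  have h3 : pd 3 f p = 0 := by nlinarith [mul_self_nonneg (pd 2 f p), mul_self_nonneg (pd 3 f p)]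
  fin_cases i <;> first | exact absurd rfl hi | assumption

/-- The metric itself is flat, so $\sigma=0$ works: curvature terms with a $u$-derivative of $H$
cancel by antisymmetry. -/
theorem locallyConformallyFlat_ppMetric (hV : IsOpen V) (hH : ContDiffOn ℝ ∞ (lift H) V)
    (h : ∀ p ∈ V, ∀ i j : Fin 4, i ≠ 0 → j ≠ 0 → pd i (pd j (lift H)) p = 0) :
    LocallyConformallyFlat (ppMetric H) V := by
  refine fun p hp => ⟨V, hV, hp, subset_rfl, fun _ => 0, contDiffOn_const,
    fun q hq i j k l => ?_⟩
  simp only [mul_zero, Real.exp_zero, one_smul]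
  rw [riemann_ppMetric hV hH i j k l hq]
  have h' := h q hq
  have hc := pd_comm hV hH
  by_cases hi : i = 0 <;> by_cases hj : j = 0 <;> by_cases hk : k = 0 <;> by_cases hl : l = 0 <;>
    simp [*]

/-- On a connected set that is not locally conformally flat, the potential has `f_v = 0`. -/
theorem IsotropicQE.pd_one_eq_zero_of_not_flat (hV : IsOpen V) (hVc : IsPreconnected V)
    (hH : ContDiffOn ℝ ∞ (lift H) V) (hW : ¬ LocallyConformallyFlat (ppMetric H) V)
    (hf : IsotropicQE (ppMetric H) V f μ) {p : Pt} (hp : p ∈ V) : pd 1 f p = 0 := by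
  by_contra hne
  exact hW <| locallyConformallyFlat_ppMetric hV hH fun q hq i j hi hj =>
    hf.pd_pd_lift_eq_zero hV hH hq
      (fun h0 => hne (hf.pd_one_eq_zero hV hVc hH hq hp h0)) hi hj

theorem IsotropicQE.equation_of_pd_one_eq_zero (hV : IsOpen V)
    (hH : ContDiffOn ℝ ∞ (lift H) V) (hf : IsotropicQE (ppMetric H) V f μ)
    {p : Pt} (hp : p ∈ V) (h : pd 1 f p = 0) :
    pd 0 (pd 0 f) p - μ * pd 0 f p ^ 2 - 1 / 2 * lapX H p = 0 := by
  have e := (hf.equations hV hH hp).2.2.2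
  rw [h, hf.pd_eq_zero hp h (i := 2) (by decide), hf.pd_eq_zero hp h (i := 3) (by decide)] at e
  linarith

theorem IsotropicQE.solvesPotentialODE (hV : IsOpen V)
    (hH : ContDiffOn ℝ ∞ (lift H) V) (hf : IsotropicQE (ppMetric H) V f μ)
    (h : ∀ p ∈ V, pd 1 f p = 0) {N : Set Pt} (hN : IsOpen N) (hNV : N ⊆ V)
    (hfN : FunctionOfU f N) : SolvesPotentialODE H μ f N := by
  obtain ⟨φ, hφ⟩ := hfN
  have hfs := hf.1.1.mono hNV
  refine ⟨φ, ?_, fun p hp => ⟨hφ p hp, ?_⟩⟩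
  · rintro _ ⟨p, hp, rfl⟩
    exact (contDiffAt_of_eq_comp hN hfs hφ hp).contDiffWithinAt
  · have h1 : ∀ q ∈ N, pd 0 f q = deriv φ (q 0) := fun q hq => deriv_eq_pd_zero hN hfs hφ hq
    rw [← deriv_eq_pd_zero hN (contDiffOn_pd hN hfs 0) h1 hp, ← h1 p hp]
    exact hf.equation_of_pd_one_eq_zero hV hH (hNV hp) (h p (hNV hp))

/-- The Laplacian of `H` is locally a function of `u` if the metric is locally isotropic
quasi-Einstein. -/
theorem LocallyIsotropicQE.locallyFunctionOfU (hH : ContDiffOn ℝ ∞ (lift H) V)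
    (h : LocallyIsotropicQE (ppMetric H) V μ) : LocallyFunctionOfU (lapX H) V := by
  intro p hp
  obtain ⟨N, hN, hpN, hNV, f, hf⟩ := h p hp
  obtain ⟨r, hr, hrN⟩ := Metric.isOpen_iff.1 hN p hpN
  have hB : IsOpen (Metric.ball p r) := Metric.isOpen_ball
  have hpB : p ∈ Metric.ball p r := Metric.mem_ball_self hr
  have hHB := hH.mono (hrN.trans hNV)
  have hfB : IsotropicQE (ppMetric H) (Metric.ball p r) f μ :=
    ⟨⟨hf.1.1.mono hrN, hf.1.2.imp fun _ hl q hq => hl q (hrN hq)⟩, fun q hq => hf.2 q (hrN hq)⟩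
  have hBc : IsPreconnected (Metric.ball p r) := (convex_ball p r).isPreconnected
  -- On the connected ball $f_v$ vanishes everywhere or nowhere. The first case gives $\Delta_xH$
  -- through the ODE, the second gives $\Delta_xH=0$.
  by_cases h1 : ∀ q ∈ Metric.ball p r, pd 1 f q = 0
  · have hloc := locallyFunctionOfU_of_pd_eq_zero hB hfB.1.1
      fun q hq i hi => hfB.pd_eq_zero hq (h1 q hq) hi
    obtain ⟨N', hN', hpN', hN'B, hfN'⟩ := hloc p hpB
    obtain ⟨φ, -, hφ⟩ := hfB.solvesPotentialODE hB hHB h1 hN' hN'B hfN'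
    refine ⟨N', hN', hpN', hN'B.trans (hrN.trans hNV),
      fun t => 2 * (deriv (deriv φ) t - μ * deriv φ t ^ 2), fun q hq => ?_⟩
    have := (hφ q hq).2
    simp only
    linarith
  · push Not at h1
    obtain ⟨q, hq, hne⟩ := h1
    refine ⟨Metric.ball p r, hB, hpB, hrN.trans hNV, fun _ => 0, fun x hx => ?_⟩
    have hx1 : pd 1 f x ≠ 0 := fun h0 => hne (hfB.pd_one_eq_zero hB hBc hHB hx hq h0)
    rw [lapX, hfB.pd_pd_lift_eq_zero hB hHB hx hx1 (by decide) (by decide),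
      hfB.pd_pd_lift_eq_zero hB hHB hx hx1 (by decide) (by decide), add_zero]

/-- If the Laplacian of `H` is locally a function of `u` then the metric is locally isotropic
quasi-Einstein for all `μ`. -/
theorem LocallyFunctionOfU.locallyIsotropicQE (hH : ContDiffOn ℝ ∞ (lift H) V)
    (h : LocallyFunctionOfU (lapX H) V) (μ : ℝ) : LocallyIsotropicQE (ppMetric H) V μ := by
  intro p hp
  obtain ⟨N, hN, hpN, hNV, φ, hφ⟩ := h p hp
  have hHN := hH.mono hNV
  have hL := contDiffOn_lapX hN hHN
  have himage : (fun q : Pt => q 0) '' N ∈ 𝓝 (p 0) :=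
    ((isOpenMap_eval 0) N hN).mem_nhds ⟨p, hpN, rfl⟩
  have hφs : ContDiffOn ℝ ∞ (fun t => 1 / 2 * φ t) ((fun q : Pt => q 0) '' N) := by
    refine contDiffOn_const.mul ?_
    rintro _ ⟨q, hq, rfl⟩
    exact (contDiffAt_of_eq_comp hN hL hφ hq).contDiffWithinAt
  -- The potential is $\psi(u)$ with $\lambda=0$. Its gradient $\psi'\partial_v$ is null, and
  -- non-zero because $\psi'\ne0$.
  obtain ⟨ψ, ε, hε, -, hψ, hψε⟩ := exists_solution_riccati μ himage hφs
  set I := Set.Ioo (p 0 - ε) (p 0 + ε) with hI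
  have hIo : IsOpen I := isOpen_Ioo
  have hc : Continuous fun q : Pt => q 0 := continuous_apply 0
  set N' := N ∩ (fun q : Pt => q 0) ⁻¹' I with hN'
  have hN'o : IsOpen N' := hN.inter (hIo.preimage hc)
  have hψ' : ContDiffOn ℝ ∞ (deriv ψ) I :=
    ((contDiffOn_infty_iff_deriv_of_isOpen hIo).1 hψ).2
  have hd : ∀ q ∈ N', ∀ i, pd i (fun p => ψ (p 0)) q = if i = 0 then deriv ψ (q 0) else 0 :=
    fun q hq i => pd_comp_zero ψ
      ((hψ.contDiffAt (hIo.mem_nhds hq.2)).differentiableAt (by simp)) i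
  have hdd : ∀ q ∈ N', ∀ i j, pd i (pd j (fun p => ψ (p 0))) q
      = if i = 0 ∧ j = 0 then deriv (deriv ψ) (q 0) else 0 := by
    intro q hq i j
    rw [pd_congr hN'o (fun x hx => hd x hx j) i hq]
    by_cases hj : j = 0
    · simp only [hj, if_true, and_true]
      exact pd_comp_zero (deriv ψ)
        ((hψ'.contDiffAt (hIo.mem_nhds hq.2)).differentiableAt (by simp)) i
    · simp [hj]
  refine ⟨N', hN'o, ⟨hpN, by simp [hI, hε]⟩, Set.inter_subset_left.trans hNV,
    fun q => ψ (q 0), ⟨⟨?_, fun _ => 0, fun q hq i j => ?_⟩, fun q hq => ?_⟩⟩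
  · exact hψ.comp (contDiff_apply ℝ ℝ (0 : Fin 4)).contDiffOn fun q hq => hq.2
  · rw [hess_ppMetric, ricci_ppMetric hN hHN i j hq.1, hdd q hq]
    simp only [hd q hq, hφ q hq.1, (hψε (q 0) hq.2).2]
    fin_cases i <;> fin_cases j <;> simp <;> ring
  · rw [lightlike_grad_ppMetric_iff]
    refine ⟨⟨0, ?_⟩, ?_⟩
    · simpa [hd q hq] using (hψε (q 0) hq.2).1
    · simp [hd q hq]

end Potential

/-- The gradient is a multiple of $\partial_v$, and $W$ has no component with an index $v$. -/
theorem weyl_ppMetric_grad {H : ℝ → ℝ → ℝ → ℝ} {U : Set Pt} (hU : IsOpen U)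
    (hH : ContDiffOn ℝ ∞ (lift H) U) {f : Pt → ℝ} {p : Pt} (hp : p ∈ U)
    (hf : ∀ i : Fin 4, i ≠ 0 → pd i f p = 0) (i j k : Fin 4) :
    ∑ l, weyl (ppMetric H) i j k l p * grad (ppMetric H) f p l = 0 := by
  simp only [grad_ppMetric, weyl_ppMetric hU hH _ _ _ _ hp, Fin.sum_univ_four]
  simp [hf, duKulkarniNomizu, diagForm, offDiagForm]
  fin_cases i <;> fin_cases j <;> simp

end PpWave

end

theorem mainTheorem2 (U : Set PpWave.Pt) (hU : IsOpen U)
    (H : ℝ → ℝ → ℝ → ℝ) (hH : ContDiffOn ℝ ∞ (PpWave.lift H) U)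
    (hW : ¬ PpWave.LocallyConformallyFlat (PpWave.ppMetric H) U) :
    List.TFAE
      [ ∃ μ : ℝ, PpWave.LocallyIsotropicQE (PpWave.ppMetric H) U μ,
        ∀ μ : ℝ, PpWave.LocallyIsotropicQE (PpWave.ppMetric H) U μ,
        PpWave.HarmonicWeyl (PpWave.ppMetric H) U,
        PpWave.LocallyFunctionOfU (PpWave.lapX H) U ] ∧
    (PpWave.ConnectedSlices U →
      (PpWave.HarmonicWeyl (PpWave.ppMetric H) U ↔ PpWave.FunctionOfU (PpWave.lapX H) U)) ∧
    (∀ V : Set PpWave.Pt, IsOpen V → IsConnected V → V ⊆ U →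
      ¬ PpWave.LocallyConformallyFlat (PpWave.ppMetric H) V →
      ∀ (μ : ℝ) (f : PpWave.Pt → ℝ), PpWave.IsotropicQE (PpWave.ppMetric H) V f μ →
        (∀ p ∈ V, ∀ i j k,
          ∑ l, PpWave.weyl (PpWave.ppMetric H) i j k l p *
            PpWave.grad (PpWave.ppMetric H) f p l = 0) ∧
        PpWave.LocallySolvesPotentialODE H μ f V ∧
        (PpWave.ConnectedSlices V → PpWave.SolvesPotentialODE H μ f V)) := by
  have hLap := PpWave.contDiffOn_lapX hU hH
  have hharm : PpWave.HarmonicWeyl (PpWave.ppMetric H) U ↔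
      PpWave.LocallyFunctionOfU (PpWave.lapX H) U := by
    rw [PpWave.harmonicWeyl_ppMetric_iff hU hH]
    exact ⟨PpWave.locallyFunctionOfU_of_pd_eq_zero hU hLap,
      fun h _ hp _ hi => h.pd_eq_zero hLap hp hi⟩
  refine ⟨?_, fun hs => ?_, ?_⟩
  · tfae_have 2 → 1 := fun h => ⟨0, h 0⟩
    tfae_have 1 → 4 := fun ⟨_, h⟩ => h.locallyFunctionOfU hH
    tfae_have 4 → 2 := fun h => h.locallyIsotropicQE hH
    tfae_have 3 ↔ 4 := hharm
    tfae_finish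
  · exact hharm.trans ⟨fun h => h.functionOfU hs, fun h => h.locally hU⟩
  · intro V hV hVc hVU hVW μ f hf
    have hHV := hH.mono hVU
    have h1 : ∀ p ∈ V, PpWave.pd 1 f p = 0 := fun p hp =>
      hf.pd_one_eq_zero_of_not_flat hV hVc.isPreconnected hHV hVW hp
    have h2 : ∀ p ∈ V, ∀ i : Fin 4, i ≠ 0 → PpWave.pd i f p = 0 := fun p hp i hi =>
      hf.pd_eq_zero hp (h1 p hp) hi
    have hloc := PpWave.locallyFunctionOfU_of_pd_eq_zero hV hf.1.1 h2
    refine ⟨fun p hp => PpWave.weyl_ppMetric_grad hV hHV hp (h2 p hp), fun p hp => ?_, fun hs => ?_⟩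
    · obtain ⟨N, hN, hpN, hNV, hfN⟩ := hloc p hp
      exact ⟨N, hN, hpN, hNV, hf.solvesPotentialODE hV hHV h1 hN hNV hfN⟩
    · exact hf.solvesPotentialODE hV hHV h1 hV subset_rfl (hloc.functionOfU hs)
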